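/- Let $H$ be the discrete Heisenberg group, that is, $\mathbb Z^3$ with the multiplication $(x,y,z)(x',y',z')=(x+x',y+y',z+z'+xy')$. Let $\Gamma_0\supseteq\Gamma_1\supseteq\cdots$ be normal subgroups of finite index in $H$ with $\bigcap_n\Gamma_n=\{e\}$. The associated Heisenberg odometer is the action of $H$ by left multiplication on the inverse limit $X=\varprojlim H/\Gamma_n$ with its normalized Haar measure $\mu$; it induces the unitary representation $(U_gf)(\mathbf x)=f(g^{-1}\mathbf x)$ of $H$ on $L^2(X,\mu)$. Suppose that for each $n$ the subgroup $\Gamma_n$ is defined by a triple $(A_n,m_n,i_n)$, where $A_n\in M(2,\mathbb Z)$ is nonsingular, $m_n\ge 1$ is an integer and $i_n:A_n\mathbb Z^2\to\mathbb Z$ is a map, in the sense that $$\Gamma_n=\{(x,y,i_n(x,y)+km_n):(x,y)\in A_n\mathbb Z^2,\ k\in\mathbb Z\}.$$ For an integer $p\ge1$, an integer $\ell$ with $\gcd(\ell,p)=1$ and real numbers $\alpha,\xi$, the triple $(\alpha,\xi,\ell/p)$ indexes the $p$-dimensional irreducible unitary representation of $H$ on $\mathbb C^p$ given, for $v=(v_0,\dots,v_{p-1})$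 and $j=0,\dots,p-1$, by $$(V_{(x,y,z)}v)_j=e^{2\pi i\left(y\xi+(z+jy)\frac{\ell}{p}+\left\lfloor\frac{x+j}{p}\right\rfloor\alpha\right)}\,v_{(j+x)\bmod p}.$$ We say that $(\alpha,\xi,\ell/p)$ lies in the spectrum of the odometer if $V$ is equivalent to one of the summands in a decomposition of $U$ into an orthogonal direct sum of finite-dimensional irreducible representations. Theorem. The triple $(\alpha,\xi,\ell/p)$ with $\gcd(\ell,p)=1$ lies in the spectrum of the odometer if and only if there exists $n$ such that $p$ divides $m_n$ and, for all $(x,y)\in A_n\mathbb Z^2$, $$y\xi+\frac{i_n(x,y)\,\ell}{p}+\frac{x}{p}\,\alpha\in\mathbb Z .$$ -/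

import Mathlib

open MeasureTheory

noncomputable section

/-! ## The discrete Heisenberg group -/

/-- The discrete Heisenberg group: the set `ℤ³` with the multiplication
`(x, y, z) (x', y', z') = (x + x', y + y', z + z' + x y')`. -/
@[ext]
structure Heisenberg where
  x : ℤ
  y : ℤ
  z : ℤ

namespace Heisenberg

instance : Mul Heisenberg := ⟨fun g h => ⟨g.x + h.x, g.y + h.y, g.z + h.z + g.x * h.y⟩⟩

instance : One Heisenberg := ⟨⟨0, 0, 0⟩⟩

instance : Inv Heisenberg := ⟨fun g => ⟨-g.x, -g.y, -g.z + g.x * g.y⟩⟩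

@[simp] theorem mul_x (g h : Heisenberg) : (g * h).x = g.x + h.x := rfl
@[simp] theorem mul_y (g h : Heisenberg) : (g * h).y = g.y + h.y := rfl
@[simp] theorem mul_z (g h : Heisenberg) : (g * h).z = g.z + h.z + g.x * h.y := rfl
@[simp] theorem one_x : (1 : Heisenberg).x = 0 := rfl
@[simp] theorem one_y : (1 : Heisenberg).y = 0 := rfl
@[simp] theorem one_z : (1 : Heisenberg).z = 0 := rfl
@[simp] theorem inv_x (g : Heisenberg) : (g⁻¹).x = -g.x := rfl
@[simp] theorem inv_y (g : Heisenberg) : (g⁻¹).y = -g.y := rfl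
@[simp] theorem inv_z (g : Heisenberg) : (g⁻¹).z = -g.z + g.x * g.y := rfl

instance : Group Heisenberg :=
  Group.ofLeftAxioms
    (fun a b c => by ext <;> simp <;> ring)
    (fun a => by ext <;> simp)
    (fun a => by ext <;> simp)

instance : TopologicalSpace Heisenberg := ⊥

instance : DiscreteTopology Heisenberg := ⟨rfl⟩

end Heisenberg

/-! ## Odometers of a discrete group -/

/-- A sequence of subgroups defining a `G` odometer: a decreasing sequence of normal subgroups of
finite index with trivial intersection. -/
structure OdometerSeq (G : Type*) [Group G] where
  sub : ℕ → Subgroup G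
  normal : ∀ n, (sub n).Normal
  finiteIndex : ∀ n, (sub n).FiniteIndex
  antitone : ∀ n, sub (n + 1) ≤ sub n
  iInf_eq_bot : ⨅ n, sub n = ⊥

namespace OdometerSeq

variable {G : Type*} [Group G] (Γ : OdometerSeq G)

instance (n : ℕ) : (Γ.sub n).Normal := Γ.normal n

instance (n : ℕ) : (Γ.sub n).FiniteIndex := Γ.finiteIndex n

/-- The projection `π_n : G / Γ_{n+1} → G / Γ_n` induced by the inclusion `Γ_{n+1} ⊆ Γ_n`. -/
def proj (n : ℕ) : G ⧸ Γ.sub (n + 1) →* G ⧸ Γ.sub n :=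
  QuotientGroup.map _ _ (MonoidHom.id G) (Γ.antitone n)

/-- The inverse limit of `(G / Γ_n, π_n)`, as a subgroup of the product of the `G / Γ_n`. -/
def invLimit : Subgroup (∀ n, G ⧸ Γ.sub n) where
  carrier := {g | ∀ n, Γ.proj n (g (n + 1)) = g n}
  mul_mem' := fun ha hb n => by
    rw [Pi.mul_apply, map_mul, ha n, hb n, Pi.mul_apply]
  one_mem' := fun n => by rw [Pi.one_apply, map_one, Pi.one_apply]
  inv_mem' := fun ha n => by
    rw [Pi.inv_apply, map_inv, ha n, Pi.inv_apply]

/-- The homomorphism `g ↦ (g Γ_n)_n` from `G` to the inverse limit. The odometer action of `g` is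
left multiplication by `Γ.embed g`. -/
def embed : G →* Γ.invLimit where
  toFun g := ⟨fun n => (g : G ⧸ Γ.sub n), fun _ => rfl⟩
  map_one' := rfl
  map_mul' _ _ := rfl

variable [TopologicalSpace G] [DiscreteTopology G]

instance (n : ℕ) : DiscreteTopology (G ⧸ Γ.sub n) :=
  QuotientGroup.discreteTopology (isOpen_discrete _)

theorem isClosed_invLimit : IsClosed (Γ.invLimit : Set (∀ n, G ⧸ Γ.sub n)) := by
  have h : (Γ.invLimit : Set (∀ n, G ⧸ Γ.sub n))
      = ⋂ n, {g | Γ.proj n (g (n + 1)) = g n} := by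
    ext g
    simp only [Set.mem_iInter, Set.mem_ofPred_eq]
    exact Iff.rfl
  rw [h]
  exact isClosed_iInter fun n =>
    isClosed_eq (continuous_of_discreteTopology.comp (continuous_apply (n + 1)))
      (continuous_apply n)

instance : CompactSpace Γ.invLimit := isCompact_iff_compactSpace.mp Γ.isClosed_invLimit.isCompact

instance : MeasurableSpace Γ.invLimit := borel _

instance : BorelSpace Γ.invLimit := ⟨rfl⟩

/-- The normalized Haar measure of the inverse limit. -/
def haar : Measure Γ.invLimit := Measure.haarMeasure ⊤

instance : Γ.haar.IsHaarMeasure := Measure.isHaarMeasure_haarMeasure _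

instance : IsProbabilityMeasure Γ.haar := ⟨Measure.haarMeasure_self (K₀ := ⊤)⟩

/-- The representation of `G` on `L²` of the inverse limit induced by the odometer action:
`(U g f) x = f (g⁻¹ x)`. -/
def koopman : Representation ℂ G (Lp ℂ 2 Γ.haar) where
  toFun g := (Lp.compMeasurePreservingₗᵢ ℂ (fun x => Γ.embed g⁻¹ * x)
    (measurePreserving_mul_left Γ.haar (Γ.embed g⁻¹))).toLinearMap
  map_one' := by
    ext1 f
    apply Lp.ext
    refine (Lp.coeFn_compMeasurePreserving f _).trans ?_
    simp [Function.comp_def]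
  map_mul' g h := by
    ext1 f
    apply Lp.ext
    refine (Lp.coeFn_compMeasurePreserving f _).trans ?_
    symm
    refine (Lp.coeFn_compMeasurePreserving _ _).trans ?_
    refine ((measurePreserving_mul_left Γ.haar
      (Γ.embed g⁻¹)).quasiMeasurePreserving.ae_eq_comp
        (Lp.coeFn_compMeasurePreserving f _)).trans ?_
    refine Filter.Eventually.of_forall fun x => ?_
    simp [mul_assoc]

end OdometerSeq

/-! ## Discrete spectrum -/

/-- `S` is a decomposition of the representation `U` on the Hilbert space `E` into finite
dimensional irreducible representations: its members are finite dimensional, irreducible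
subrepresentations that are mutually orthogonal, and their (algebraic) sum is dense in `E`. -/
structure IsSpectralDecomposition {G E : Type*} [Group G] [NormedAddCommGroup E]
    [InnerProductSpace ℂ E] (U : Representation ℂ G E) (S : Set (Subrepresentation U)) : Prop where
  finiteDimensional : ∀ V ∈ S, FiniteDimensional ℂ V.toSubmodule
  irreducible : ∀ V ∈ S, V.toRepresentation.IsIrreducible
  orthogonal : ∀ V ∈ S, ∀ W ∈ S, V ≠ W → V.toSubmodule ⟂ W.toSubmodule
  dense : (⨆ V ∈ S, V.toSubmodule).topologicalClosure = ⊤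

/-- The representation `ρ` occurs in the spectral decomposition of `U`: it is equivalent to one of
the summands of a decomposition of `U` into finite dimensional irreducible representations. -/
def OccursIn {G E F : Type*} [Group G] [NormedAddCommGroup E] [InnerProductSpace ℂ E]
    [AddCommGroup F] [Module ℂ F] (ρ : Representation ℂ G F) (U : Representation ℂ G E) : Prop :=
  ∃ S : Set (Subrepresentation U), IsSpectralDecomposition U S ∧
    ∃ V ∈ S, Nonempty (ρ.Equiv V.toRepresentation)

namespace Heisenberg

/-! ## The finite dimensional irreducible representations of the Heisenberg group -/

/-- The phase `exp (2πi (y ξ + (z + j y) ℓ/p + [(x + j)/p] α))`. -/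
def phase (p : ℕ) (α ξ : ℝ) (l : ℤ) (g : Heisenberg) (j : ℕ) : ℂ :=
  Complex.exp (2 * Real.pi * Complex.I *
    (((g.y : ℝ) * ξ + ((g.z + j * g.y : ℤ) : ℝ) * ((l : ℝ) / p)
      + (⌊((g.x + j : ℤ) : ℝ) / (p : ℝ)⌋ : ℝ) * α : ℝ) : ℂ))

theorem phase_one (p : ℕ) [NeZero p] (α ξ : ℝ) (l : ℤ) (j : ZMod p) :
    phase p α ξ l 1 j.val = 1 := by
  have hp : (0 : ℝ) < p := by exact_mod_cast Nat.pos_of_ne_zero (NeZero.ne p)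
  have hfl : ⌊(((1 : Heisenberg).x + (j.val : ℕ) : ℤ) : ℝ) / (p : ℝ)⌋ = 0 := by
    have h1 : (((1 : Heisenberg).x + (j.val : ℕ) : ℤ) : ℝ) = (j.val : ℝ) := by
      rw [one_x, zero_add, Int.cast_natCast]
    have h2 : (j.val : ℝ) < p := by exact_mod_cast ZMod.val_lt j
    rw [h1, Int.floor_eq_zero_iff]
    exact ⟨by positivity, (div_lt_one hp).mpr h2⟩
  unfold phase
  rw [hfl]
  simp

theorem phase_mul (p : ℕ) [NeZero p] (α ξ : ℝ) (l : ℤ) (g h : Heisenberg) (j : ZMod p) :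
    phase p α ξ l (g * h) j.val
      = phase p α ξ l g j.val * phase p α ξ l h (j + (g.x : ZMod p)).val := by
  have hp : (0 : ℝ) < p := by exact_mod_cast Nat.pos_of_ne_zero (NeZero.ne p)
  obtain ⟨q, hq⟩ : (p : ℤ) ∣ (g.x + j.val) - (j + (g.x : ZMod p)).val := by
    rw [← ZMod.intCast_zmod_eq_zero_iff_dvd]
    push_cast
    simp only [ZMod.natCast_val, ZMod.cast_id', id_eq]
    ring
  set k : ℕ := (j + (g.x : ZMod p)).val with hk
  have hklt : k < p := ZMod.val_lt _
  have hg : g.x + (j.val : ℤ) = k + p * q := by linarith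
  have e1 : ⌊((g.x + (j.val : ℕ) : ℤ) : ℝ) / (p : ℝ)⌋ = q := by
    rw [hg, Int.floor_eq_iff, le_div_iff₀ hp, div_lt_iff₀ hp]
    have : (k : ℝ) < p := by exact_mod_cast hklt
    have : (0 : ℝ) ≤ k := by positivity
    push_cast
    constructor <;> nlinarith
  have e2 : ⌊(((g * h).x + (j.val : ℕ) : ℤ) : ℝ) / (p : ℝ)⌋
      = q + ⌊((h.x + (k : ℕ) : ℤ) : ℝ) / (p : ℝ)⌋ := by
    have : (((g * h).x + (j.val : ℕ) : ℤ) : ℝ) / (p : ℝ)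
        = (q : ℝ) + ((h.x + (k : ℕ) : ℤ) : ℝ) / (p : ℝ) := by
      have h' : (g * h).x + (j.val : ℤ) = p * q + (h.x + k) := by
        simp only [mul_x]; linarith
      rw [h']
      push_cast
      field_simp
    rw [this, Int.floor_intCast_add]
  unfold phase
  rw [e1, e2, ← Complex.exp_add, Complex.exp_eq_exp_iff_exists_int]
  refine ⟨q * h.y * l, ?_⟩
  have hgx : (g.x : ℂ) = k + p * q - j.val := by
    have : (g.x : ℤ) = k + p * q - j.val := by linarith
    exact_mod_cast congrArg (Int.cast : ℤ → ℂ) this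
  have hpc : (p : ℂ) ≠ 0 := by exact_mod_cast (NeZero.ne p)
  simp only [mul_y, mul_z]
  push_cast
  rw [hgx]
  field_simp
  ring

/-- The `p`-dimensional representation of the Heisenberg group with the parameters `(α, ξ, ℓ/p)`,
on the space of vectors `(v_0, …, v_{p-1})`; the `j`-th coordinate of `U_{(x,y,z)} v` is
`exp (2πi (y ξ + (z + j y) ℓ/p + [(x + j)/p] α)) v_{(j + x) mod p}`. -/
def irrep (p : ℕ) [NeZero p] (α ξ : ℝ) (l : ℤ) :
    Representation ℂ Heisenberg (EuclideanSpace ℂ (ZMod p)) where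
  toFun g :=
    { toFun := fun v => WithLp.toLp 2 fun j => phase p α ξ l g j.val * v (j + (g.x : ZMod p))
      map_add' := fun v w => by ext j; simp [mul_add]
      map_smul' := fun c v => by ext j; simp; ring }
  map_one' := by
    ext v j
    simp [phase_one]
  map_mul' g h := by
    ext v j
    simp [phase_mul, mul_assoc, add_assoc]

/-! ## Triples defining subgroups -/

/-- The subset `A ℤ²` of `ℤ²`. -/
abbrev lattice (A : Matrix (Fin 2) (Fin 2) ℤ) : Set (Fin 2 → ℤ) := Set.range A.mulVec

/-- The subgroup `Γ` is defined by the triple `(A, m, i)`: `A` is nonsingular, `m ≥ 1`, and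
`Γ = {(x, y, i(x, y) + k m) : (x, y) ∈ A ℤ², k ∈ ℤ}`. -/
structure IsDefinedBy (Γ : Subgroup Heisenberg) (A : Matrix (Fin 2) (Fin 2) ℤ) (m : ℕ)
    (i : lattice A → ℤ) : Prop where
  det_ne_zero : A.det ≠ 0
  one_le : 1 ≤ m
  coe_eq : (Γ : Set Heisenberg)
    = {g | ∃ (v : lattice A) (k : ℤ), g = ⟨v.1 0, v.1 1, i v + k * m⟩}

end Heisenberg

end

/-!
A finite dimensional irreducible representation occurs in an odometer if and only if it is trivial
on one of the subgroups `Γ_n` (`OdometerSeq.occursIn_koopman_iff`). This holds for odometers of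
every discrete group and rests on the finite dimensional invariant spaces `Γ.level n` of functions
on the inverse limit that factor through `G / Γ_n`. They span a dense subspace of `L²`, because the
cylinder sets form a π-system generating the Borel sets (`eq_zero_of_forall_inner_level`), and
`Γ_n` acts trivially on `Γ.level n`, because it is normal.

* An irreducible summand `V` is not orthogonal to `Γ.level n` for some `n`. The vectors of `V`
  orthogonal to `Γ.level n` form a proper invariant subspace, which is therefore `0`; it contains
  `U_g v - v` for `g ∈ Γ_n`, hence `Γ_n` acts trivially on `V`
  (`Representation.exists_forall_apply_eq_self`).
* Conversely, an irreducible representation that is trivial on `Γ_n` embeds into `L²` by its matrix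
  coefficients (`exists_injective_intertwiningMap`), and its image belongs to a maximal orthogonal
  family of finite dimensional irreducible subrepresentations. Such a family spans a dense
  subspace, since the projection of some `Γ.level n` to the orthogonal complement would otherwise
  provide a further member (`Representation.exists_isSpectralDecomposition_mem`).

For the Heisenberg group it remains to see that the given representations are irreducible
(`Heisenberg.irrep_isIrreducible`) and to compute when they are trivial on a normal subgroup defined
by a triple (`Heisenberg.IsDefinedBy.forall_irrep_eq_one_iff`).
-/

open scoped InnerProductSpace

/-! ### Irreducible subrepresentations -/

namespace Representation

section Algebraic

variable {G k V W : Type*} [Monoid G] [Field k] [AddCommGroup V] [Module k V] [AddCommGroup W]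
  [Module k W] {ρ : Representation k G V} {σ : Representation k G W}

theorem IsIrreducible.of_forall_eq_top [Nontrivial V]
    (h : ∀ K : Subrepresentation ρ, ∀ v ∈ K.toSubmodule, v ≠ 0 → K.toSubmodule = ⊤) :
    ρ.IsIrreducible := by
  obtain ⟨v, hv⟩ := exists_ne (0 : V)
  have : Nontrivial (Subrepresentation ρ) := by
    refine ⟨⊥, ⊤, fun e => hv ?_⟩
    have hmem : v ∈ (⊤ : Subrepresentation ρ).toSubmodule := Submodule.mem_top
    rw [← e] at hmem
    exact (Submodule.mem_bot k).mp hmem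
  refine ⟨fun K => or_iff_not_imp_left.mpr fun hK => ?_⟩
  have hK' : K.toSubmodule ≠ ⊥ := fun e => hK (Subrepresentation.toSubmodule_injective e)
  obtain ⟨w, hw, hw0⟩ := K.toSubmodule.exists_mem_ne_zero_of_ne_bot hK'
  exact Subrepresentation.toSubmodule_injective (h K w hw hw0)

theorem IsIrreducible.nontrivial (hρ : ρ.IsIrreducible) : Nontrivial V := by
  by_contra h
  rw [not_nontrivial_iff_subsingleton] at h
  exact bot_ne_top (α := Subrepresentation ρ)
    (Subrepresentation.toSubmodule_injective (Subsingleton.elim _ _))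

theorem IsIrreducible.toSubmodule_eq_top (hρ : ρ.IsIrreducible) (K : Subrepresentation ρ)
    {v : V} (hv : v ∈ K.toSubmodule) (hv0 : v ≠ 0) : K.toSubmodule = ⊤ := by
  rcases hρ.eq_bot_or_eq_top K with h | h
  · rw [h] at hv
    exact absurd ((Submodule.mem_bot k).mp hv) hv0
  · rw [h]; rfl

theorem IsIrreducible.of_equiv (hρ : ρ.IsIrreducible) (e : ρ.Equiv σ) : σ.IsIrreducible := by
  have := hρ.nontrivial
  have : Nontrivial W := e.toLinearEquiv.toEquiv.symm.nontrivial
  refine .of_forall_eq_top fun K w hw hw0 => ?_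
  let K' : Subrepresentation ρ :=
    ⟨K.toSubmodule.comap e.toLinearEquiv.toLinearMap, fun g v hv => by
      have := K.apply_mem_toSubmodule g hv
      rwa [Submodule.mem_comap, LinearEquiv.coe_coe, Equiv.toLinearEquiv_apply,
        IntertwiningMap.isIntertwining]⟩
  have hK' : K'.toSubmodule = ⊤ := by
    refine hρ.toSubmodule_eq_top K' (v := e.toLinearEquiv.symm w) ?_
      (e.toLinearEquiv.symm.map_ne_zero_iff.mpr hw0)
    rwa [← e.toLinearEquiv.apply_symm_apply w] at hw
  rw [eq_top_iff]
  intro x _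
  have hx : e.toLinearEquiv.symm x ∈ K'.toSubmodule := hK' ▸ Submodule.mem_top
  have hx' : e.toLinearEquiv (e.toLinearEquiv.symm x) ∈ K.toSubmodule := hx
  rwa [e.toLinearEquiv.apply_symm_apply] at hx'

/-- An injective intertwining map is an equivalence onto its range. -/
noncomputable def IntertwiningMap.equivRange (f : IntertwiningMap ρ σ)
    (hf : Function.Injective f) : ρ.Equiv f.range.toRepresentation :=
  Equiv.mk (LinearEquiv.ofInjective f.toLinearMap hf) fun g => by
    ext v
    exact f.isIntertwining _ _ g v

/-- A subrepresentation of minimal positive dimension is irreducible. -/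
theorem exists_irreducible_le (K : Subrepresentation ρ) [FiniteDimensional k K.toSubmodule]
    (hK : K.toSubmodule ≠ ⊥) :
    ∃ L : Subrepresentation ρ, L.toSubmodule ≤ K.toSubmodule ∧
      FiniteDimensional k L.toSubmodule ∧ L.toRepresentation.IsIrreducible := by
  let T : Set (Subrepresentation ρ) := {L | L.toSubmodule ≤ K.toSubmodule ∧ L.toSubmodule ≠ ⊥}
  have hT : T.Nonempty := ⟨K, le_rfl, hK⟩
  obtain ⟨L, ⟨hLK, hL⟩, hmin⟩ := (measure fun L : Subrepresentation ρ =>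
    Module.finrank k L.toSubmodule).wf.has_min T hT
  have hfd : FiniteDimensional k L.toSubmodule := Submodule.finiteDimensional_of_le hLK
  refine ⟨L, hLK, hfd, ?_⟩
  have : Nontrivial L.toSubmodule := Submodule.nontrivial_iff_ne_bot.mpr hL
  refine .of_forall_eq_top fun M v hv hv0 => ?_
  let M' : Subrepresentation ρ := ⟨M.toSubmodule.map L.toSubmodule.subtype, by
    rintro g _ ⟨w, hw, rfl⟩
    exact ⟨L.toRepresentation g w, M.apply_mem_toSubmodule g hw, rfl⟩⟩
  have hM'L : M'.toSubmodule ≤ L.toSubmodule := Submodule.map_subtype_le _ _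
  have hM' : M' ∈ T := by
    refine ⟨hM'L.trans hLK, fun e => hv0 ?_⟩
    have hmem : (v : V) ∈ M'.toSubmodule := ⟨v, hv, rfl⟩
    rw [e, Submodule.mem_bot] at hmem
    exact Subtype.ext hmem
  have heq : M'.toSubmodule = L.toSubmodule :=
    Submodule.eq_of_le_of_finrank_le hM'L (not_lt.mp (hmin M' hM'))
  rw [eq_top_iff]
  intro w _
  have hw : (w : V) ∈ M'.toSubmodule := heq.ge w.2
  obtain ⟨u, hu, huw⟩ := hw
  rwa [← Subtype.ext huw]

end Algebraic

/-! ### Unitary representations exhausted by finite dimensional ones -/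

section Unitary

variable {G E : Type*} [Group G] [NormedAddCommGroup E] [InnerProductSpace ℂ E]
  {U : Representation ℂ G E}

theorem inner_apply_right (hU : ∀ g x y, ⟪U g x, U g y⟫_ℂ = ⟪x, y⟫_ℂ) (g : G) (x y : E) :
    ⟪x, U g y⟫_ℂ = ⟪U g⁻¹ x, y⟫_ℂ := by
  rw [← hU g (U g⁻¹ x) y, self_inv_apply]

theorem apply_mem_orthogonal (hU : ∀ g x y, ⟪U g x, U g y⟫_ℂ = ⟪x, y⟫_ℂ) {K : Submodule ℂ E}
    (hK : ∀ g, ∀ x ∈ K, U g x ∈ K) (g : G) {x : E} (hx : x ∈ Kᗮ) : U g x ∈ Kᗮ := by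
  intro y hy
  rw [inner_apply_right hU]
  exact hx _ (hK _ _ hy)

/-- The orthogonal projection onto an invariant subspace whose orthogonal complement is also
invariant commutes with the representation. -/
theorem apply_starProjection {K : Submodule ℂ E} [K.HasOrthogonalProjection]
    (hK : ∀ g, ∀ x ∈ K, U g x ∈ K) (hK' : ∀ g, ∀ x ∈ Kᗮ, U g x ∈ Kᗮ) (g : G) (x : E) :
    K.starProjection (U g x) = U g (K.starProjection x) := by
  refine Submodule.eq_starProjection_of_mem_orthogonal
    (hK g _ (K.starProjection_apply_mem x)) ?_
  rw [← map_sub]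
  exact hK' g _ (Submodule.sub_starProjection_mem_orthogonal x)

/-- A nonzero closed invariant subspace, here written as an orthogonal complement, contains a
finite dimensional irreducible subrepresentation: the projection to it of one of the spaces `F n`
is nonzero, invariant and finite dimensional. -/
theorem exists_irreducible_le_orthogonal [CompleteSpace E]
    (hU : ∀ g x y, ⟪U g x, U g y⟫_ℂ = ⟪x, y⟫_ℂ) {ι : Type*} (F : ι → Subrepresentation U)
    (hfd : ∀ n, FiniteDimensional ℂ (F n).toSubmodule)
    (hF : ∀ x, (∀ n, ∀ y ∈ (F n).toSubmodule, ⟪y, x⟫_ℂ = 0) → x = 0)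
    {K : Submodule ℂ E} (hK : ∀ g, ∀ x ∈ K, U g x ∈ K) (hK0 : Kᗮ ≠ ⊥) :
    ∃ L : Subrepresentation U, L.toSubmodule ≤ Kᗮ ∧ FiniteDimensional ℂ L.toSubmodule ∧
      L.toRepresentation.IsIrreducible := by
  have h1 : ∀ g, ∀ x ∈ Kᗮ, U g x ∈ Kᗮ := fun g x => apply_mem_orthogonal hU hK g
  have h2 : ∀ g, ∀ x ∈ Kᗮᗮ, U g x ∈ Kᗮᗮ := fun g x => apply_mem_orthogonal hU h1 g
  obtain ⟨x, hx, hx0⟩ := Kᗮ.exists_mem_ne_zero_of_ne_bot hK0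
  obtain ⟨n, y, hy, hyx⟩ : ∃ n, ∃ y ∈ (F n).toSubmodule, ⟪y, x⟫_ℂ ≠ 0 := by
    by_contra! h
    exact hx0 (hF x h)
  let L : Subrepresentation U :=
    ⟨(F n).toSubmodule.map Kᗮ.starProjection.toLinearMap, by
      rintro g _ ⟨w, hw, rfl⟩
      exact ⟨U g w, (F n).apply_mem_toSubmodule g hw, apply_starProjection h1 h2 g w⟩⟩
  have hLK : L.toSubmodule ≤ Kᗮ := by
    rintro _ ⟨w, -, rfl⟩
    exact Kᗮ.starProjection_apply_mem w
  have : FiniteDimensional ℂ L.toSubmodule := by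
    have := hfd n
    exact inferInstanceAs (FiniteDimensional ℂ ((F n).toSubmodule.map _))
  have hL : L.toSubmodule ≠ ⊥ := by
    intro e
    have hmem : Kᗮ.starProjection y ∈ L.toSubmodule := ⟨y, hy, rfl⟩
    rw [e, Submodule.mem_bot] at hmem
    apply hyx
    rw [← Submodule.starProjection_eq_self_iff.mpr hx,
      ← Submodule.inner_starProjection_left_eq_right, hmem, inner_zero_left]
  obtain ⟨M, hML, h⟩ := exists_irreducible_le L hL
  exact ⟨M, hML.trans hLK, h⟩

/-- Every finite dimensional irreducible subrepresentation is a member of some spectral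
decomposition: a maximal orthogonal family of such subrepresentations containing the given one
spans a dense subspace. -/
theorem exists_isSpectralDecomposition_mem [CompleteSpace E]
    (hU : ∀ g x y, ⟪U g x, U g y⟫_ℂ = ⟪x, y⟫_ℂ) {ι : Type*} (F : ι → Subrepresentation U)
    (hfd : ∀ n, FiniteDimensional ℂ (F n).toSubmodule)
    (hF : ∀ x, (∀ n, ∀ y ∈ (F n).toSubmodule, ⟪y, x⟫_ℂ = 0) → x = 0)
    (V : Subrepresentation U) (hV : FiniteDimensional ℂ V.toSubmodule)
    (hV' : V.toRepresentation.IsIrreducible) :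
    ∃ S : Set (Subrepresentation U), IsSpectralDecomposition U S ∧ V ∈ S := by
  let P : Set (Set (Subrepresentation U)) := {S |
    (∀ W ∈ S, FiniteDimensional ℂ W.toSubmodule ∧ W.toRepresentation.IsIrreducible) ∧
      S.Pairwise fun W W' => W.toSubmodule ⟂ W'.toSubmodule}
  have hVP : {V} ∈ P := by
    refine ⟨?_, Set.pairwise_singleton _ _⟩
    rintro W rfl
    exact ⟨hV, hV'⟩
  obtain ⟨S, hVS, ⟨hSP, hmax⟩⟩ := zorn_subset_nonempty P (fun c hcP hc _ => by
    refine ⟨⋃₀ c, ⟨?_, ?_⟩, fun s hs => Set.subset_sUnion_of_mem hs⟩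
    · rintro W ⟨s, hs, hW⟩
      exact (hcP hs).1 W hW
    · exact (Set.pairwise_sUnion hc.directedOn).mpr fun s hs => (hcP hs).2) {V} hVP
  refine ⟨S, ⟨fun W hW => (hSP.1 W hW).1, fun W hW => (hSP.1 W hW).2,
    fun W hW W' hW' h => hSP.2 hW hW' h, ?_⟩, hVS rfl⟩
  rw [Submodule.topologicalClosure_eq_top_iff]
  by_contra hne
  have hle : ∀ W ∈ S, W.toSubmodule ≤ ⨆ W ∈ S, W.toSubmodule := fun W hW =>
    le_iSup₂_of_le W hW le_rfl
  have hinv : ∀ g, ∀ x ∈ ⨆ W ∈ S, W.toSubmodule, U g x ∈ ⨆ W ∈ S, W.toSubmodule := by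
    intro g
    refine iSup₂_le (a := Submodule.comap (U g) (⨆ W ∈ S, W.toSubmodule)) fun W hW x hx => ?_
    exact hle W hW (W.apply_mem_toSubmodule g hx)
  obtain ⟨L, hL, hLfd, hLirr⟩ := exists_irreducible_le_orthogonal hU F hfd hF hinv hne
  have hperp : ∀ W ∈ S, W.toSubmodule ⟂ L.toSubmodule := fun W hW =>
    (Submodule.isOrtho_orthogonal_right _).mono (hle W hW) hL
  have hLS : L ∈ S := by
    refine hmax (y := insert L S) ⟨?_, ?_⟩ (Set.subset_insert _ _) (Set.mem_insert _ _)
    · rintro W (rfl | hW)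
      exacts [⟨hLfd, hLirr⟩, hSP.1 W hW]
    · exact hSP.2.insert fun W hW _ => ⟨(hperp W hW).symm, hperp W hW⟩
  have := hLirr.nontrivial
  exact Submodule.nontrivial_iff_ne_bot.mp this (Submodule.isOrtho_self.mp (hperp L hLS))

/-- An irreducible subrepresentation is not orthogonal to all the spaces `F n`; being irreducible,
it then meets the orthogonal complement of one of them in `0` only. Hence an element of the group
which acts trivially on that `F n` acts trivially on the subrepresentation. -/
theorem exists_forall_apply_eq_self (hU : ∀ g x y, ⟪U g x, U g y⟫_ℂ = ⟪x, y⟫_ℂ) {ι : Type*}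
    (F : ι → Subrepresentation U)
    (hF : ∀ x, (∀ n, ∀ y ∈ (F n).toSubmodule, ⟪y, x⟫_ℂ = 0) → x = 0)
    (V : Subrepresentation U) (hV : V.toRepresentation.IsIrreducible) :
    ∃ n, ∀ g, (∀ y ∈ (F n).toSubmodule, U g⁻¹ y = y) → ∀ v ∈ V.toSubmodule, U g v = v := by
  have := hV.nontrivial
  obtain ⟨x, hx0⟩ := exists_ne (0 : V.toSubmodule)
  obtain ⟨n, y, hy, hyx⟩ : ∃ n, ∃ y ∈ (F n).toSubmodule, ⟪y, (x : E)⟫_ℂ ≠ 0 := by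
    by_contra! h
    exact hx0 (Subtype.ext (hF x h))
  refine ⟨n, fun g hg v hv => ?_⟩
  let K : Subrepresentation V.toRepresentation :=
    ⟨(F n).toSubmoduleᗮ.comap V.toSubmodule.subtype, fun h w hw =>
      apply_mem_orthogonal hU (fun g x hx => (F n).apply_mem_toSubmodule g hx) h hw⟩
  have hw : U g v - v ∈ V.toSubmodule := sub_mem (V.apply_mem_toSubmodule g hv) hv
  have hwK : (⟨U g v - v, hw⟩ : V.toSubmodule) ∈ K.toSubmodule := by
    intro z hz
    change ⟪z, U g v - v⟫_ℂ = 0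
    rw [inner_sub_right, inner_apply_right hU, hg z hz, sub_self]
  by_contra hne
  have htop := hV.toSubmodule_eq_top K hwK fun e => hne (sub_eq_zero.mp (congrArg Subtype.val e))
  have hxK : x ∈ K.toSubmodule := htop ▸ Submodule.mem_top
  exact hyx (hxK y hy)

end Unitary

end Representation

/-! ### The functions that factor through a finite quotient -/

namespace OdometerSeq

variable {G : Type*} [Group G] (Γ : OdometerSeq G)

theorem eq_of_le_of_eq {x y : Γ.invLimit} {n k : ℕ} (hnk : n ≤ k) (h : x.1 k = y.1 k) :
    x.1 n = y.1 n := by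
  induction k, hnk using Nat.le_induction with
  | base => exact h
  | succ k _ ih => exact ih (by rw [← x.2 k, ← y.2 k, h])

theorem isPiSystem_cylinders :
    IsPiSystem {s : Set Γ.invLimit | ∃ n c, s = {x | x.1 n = c}} := by
  have key : ∀ {n k : ℕ} (c d) {z : Γ.invLimit}, n ≤ k → z.1 n = c → z.1 k = d →
      {x : Γ.invLimit | x.1 n = c} ∩ {x | x.1 k = d} = {x | x.1 k = d} := by
    rintro n k c d z hnk rfl rfl
    exact Set.inter_eq_right.mpr fun y hy => Γ.eq_of_le_of_eq hnk hy
  rintro _ ⟨n, c, rfl⟩ _ ⟨k, d, rfl⟩ ⟨z, hz1, hz2⟩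
  rcases le_total n k with h | h
  · exact ⟨k, d, key c d h hz1 hz2⟩
  · exact ⟨n, c, by rw [Set.inter_comm]; exact key d c h hz2 hz1⟩

variable [TopologicalSpace G]

theorem continuous_coord (n : ℕ) : Continuous fun x : Γ.invLimit => x.1 n :=
  (continuous_apply n).comp continuous_subtype_val

variable [DiscreteTopology G]

theorem isTopologicalBasis_cylinders :
    TopologicalSpace.IsTopologicalBasis
      {s : Set Γ.invLimit | ∃ n c, s = {x | x.1 n = c}} := by
  refine TopologicalSpace.isTopologicalBasis_of_isOpen_of_nhds ?_ fun x u hx hu => ?_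
  · rintro _ ⟨n, c, rfl⟩
    exact (isOpen_discrete {c}).preimage (Γ.continuous_coord n)
  · obtain ⟨v, hv, rfl⟩ := isOpen_induced_iff.mp hu
    obtain ⟨I, t, ht, hIv⟩ := isOpen_pi_iff.mp hv x.1 hx
    refine ⟨_, ⟨I.sup id, x.1 (I.sup id), rfl⟩, rfl, fun y hy => hIv fun n hn => ?_⟩
    rw [show y.1 n = x.1 n from Γ.eq_of_le_of_eq (Finset.le_sup (f := id) hn) hy]
    exact (ht n hn).2

theorem measurableSpace_eq_generateFrom_cylinders :
    (inferInstance : MeasurableSpace Γ.invLimit)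
      = MeasurableSpace.generateFrom {s | ∃ n c, s = {x | x.1 n = c}} := by
  have : ∀ n, Countable (G ⧸ Γ.sub n) := fun n => Finite.to_countable
  have : SecondCountableTopology (∀ n, G ⧸ Γ.sub n) := inferInstance
  have : SecondCountableTopology Γ.invLimit :=
    TopologicalSpace.Subtype.secondCountableTopology _
  rw [BorelSpace.measurable_eq (α := Γ.invLimit)]
  exact Γ.isTopologicalBasis_cylinders.borel_eq_generateFrom

/-- The embedding of the functions on `G / Γ_n` into `L²` of the inverse limit. -/
noncomputable def levelMap (n : ℕ) : (G ⧸ Γ.sub n → ℂ) →ₗ[ℂ] Lp ℂ 2 Γ.haar :=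
  (ContinuousMap.toLp 2 Γ.haar ℂ).toLinearMap ∘ₗ
    { toFun := fun φ =>
        (⟨fun x => φ (x.1 n), continuous_of_discreteTopology.comp (Γ.continuous_coord n)⟩ :
          C(Γ.invLimit, ℂ))
      map_add' := fun _ _ => rfl
      map_smul' := fun _ _ => rfl }

theorem coeFn_levelMap (n : ℕ) (φ : G ⧸ Γ.sub n → ℂ) :
    Γ.levelMap n φ =ᵐ[Γ.haar] fun x => φ (x.1 n) :=
  ContinuousMap.coeFn_toLp Γ.haar _

theorem eq_zero_of_levelMap_eq_zero {n : ℕ} {φ : G ⧸ Γ.sub n → ℂ} (h : Γ.levelMap n φ = 0)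
    (x : Γ.invLimit) : φ (x.1 n) = 0 := by
  have h1 : (fun x : Γ.invLimit => φ (x.1 n)) =ᵐ[Γ.haar] fun _ => 0 := by
    refine (Γ.coeFn_levelMap n φ).symm.trans ?_
    rw [h]
    exact Lp.coeFn_zero ℂ 2 Γ.haar
  exact congrFun (Continuous.ae_eq_iff_eq Γ.haar
    (continuous_of_discreteTopology.comp (Γ.continuous_coord n)) continuous_const |>.mp h1) x

theorem coeFn_koopman (g : G) (f : Lp ℂ 2 Γ.haar) :
    Γ.koopman g f =ᵐ[Γ.haar] fun x => f (Γ.embed g⁻¹ * x) :=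
  Lp.coeFn_compMeasurePreserving f (measurePreserving_mul_left Γ.haar (Γ.embed g⁻¹))

theorem koopman_levelMap (g : G) (n : ℕ) (φ : G ⧸ Γ.sub n → ℂ) :
    Γ.koopman g (Γ.levelMap n φ) = Γ.levelMap n fun c => φ ((g⁻¹ : G) * c) := by
  apply Lp.ext
  have h := (measurePreserving_mul_left Γ.haar
    (Γ.embed g⁻¹)).quasiMeasurePreserving.ae_eq_comp (Γ.coeFn_levelMap n φ)
  filter_upwards [Γ.coeFn_koopman g (Γ.levelMap n φ), h, Γ.coeFn_levelMap n _] with x h1 h2 h3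
  rw [h1, h3]
  exact h2

theorem inner_koopman (g : G) (f f' : Lp ℂ 2 Γ.haar) :
    ⟪Γ.koopman g f, Γ.koopman g f'⟫_ℂ = ⟪f, f'⟫_ℂ :=
  (Lp.compMeasurePreservingₗᵢ ℂ (fun x => Γ.embed g⁻¹ * x)
    (measurePreserving_mul_left Γ.haar (Γ.embed g⁻¹))).inner_map_map f f'

/-- The subrepresentation of the functions that factor through `G / Γ_n`. -/
noncomputable def level (n : ℕ) : Subrepresentation Γ.koopman :=
  ⟨LinearMap.range (Γ.levelMap n), by
    rintro g _ ⟨φ, rfl⟩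
    exact ⟨_, (Γ.koopman_levelMap g n φ).symm⟩⟩

theorem finiteDimensional_level (n : ℕ) : FiniteDimensional ℂ (Γ.level n).toSubmodule := by
  have : Finite (G ⧸ Γ.sub n) := inferInstance
  exact inferInstanceAs (FiniteDimensional ℂ (LinearMap.range (Γ.levelMap n)))

/-- By normality, `Γ_n` acts trivially on the functions that factor through `G / Γ_n`. -/
theorem koopman_apply_of_mem {n : ℕ} {g : G} (hg : g ∈ Γ.sub n) {f : Lp ℂ 2 Γ.haar}
    (hf : f ∈ (Γ.level n).toSubmodule) : Γ.koopman g f = f := by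
  obtain ⟨φ, rfl⟩ := hf
  have h : ((g⁻¹ : G) : G ⧸ Γ.sub n) = 1 := (QuotientGroup.eq_one_iff _).mpr (inv_mem hg)
  simp only [koopman_levelMap, h, one_mul]

theorem setIntegral_cylinder_eq_inner (f : Lp ℂ 2 Γ.haar) (n : ℕ) (c : G ⧸ Γ.sub n) :
    ∃ y ∈ (Γ.level n).toSubmodule, ∫ x in {x | x.1 n = c}, f x ∂Γ.haar = ⟪y, f⟫_ℂ := by
  classical
  have hs : MeasurableSet {x : Γ.invLimit | x.1 n = c} :=
    ((isOpen_discrete {c}).preimage (Γ.continuous_coord n)).measurableSet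
  refine ⟨_, ⟨Pi.single c 1, rfl⟩, ?_⟩
  rw [L2.inner_def, ← integral_indicator hs]
  refine integral_congr_ae ?_
  filter_upwards [Γ.coeFn_levelMap n (Pi.single c 1)] with x hx
  rw [hx]
  by_cases h : x.1 n = c
  · simp [h]
  · simp [h]

/-- The functions that factor through some `G / Γ_n` span a dense subspace of `L²`: a function
orthogonal to all of them has integral zero on every cylinder set, hence on every measurable
set. -/
theorem eq_zero_of_forall_inner_level (f : Lp ℂ 2 Γ.haar)
    (hf : ∀ n, ∀ y ∈ (Γ.level n).toSubmodule, ⟪y, f⟫_ℂ = 0) : f = 0 := by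
  have hint : Integrable f Γ.haar := (Lp.memLp f).integrable one_le_two
  have hcyl : ∀ n (c : G ⧸ Γ.sub n), ∫ x in {x | x.1 n = c}, f x ∂Γ.haar = 0 := by
    intro n c
    obtain ⟨y, hy, h⟩ := Γ.setIntegral_cylinder_eq_inner f n c
    rw [h, hf n y hy]
  have huniv : ∫ x, f x ∂Γ.haar = 0 := by
    rw [← hf 0 (Γ.levelMap 0 fun _ => 1) ⟨_, rfl⟩, L2.inner_def]
    refine integral_congr_ae ?_
    filter_upwards [Γ.coeFn_levelMap 0 fun _ => 1] with x hx
    rw [hx]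
    simp
  have hset : ∀ s, MeasurableSet s → ∫ x in s, f x ∂Γ.haar = 0 := by
    intro s hs
    induction s, hs using MeasurableSpace.induction_on_inter
      Γ.measurableSpace_eq_generateFrom_cylinders Γ.isPiSystem_cylinders with
    | empty => simp
    | basic t ht =>
      obtain ⟨n, c, rfl⟩ := ht
      exact hcyl n c
    | compl t ht ih =>
      have := integral_add_compl ht hint
      rwa [ih, zero_add, huniv] at this
    | iUnion t hd ht ih =>
      rw [integral_iUnion ht hd hint.integrableOn]
      simp [ih]
  rw [Lp.eq_zero_iff_ae_eq_zero]
  exact hint.ae_eq_zero_of_forall_setIntegral_eq_zero fun s hs _ => hset s hs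

/-! ### The irreducible representations that occur in an odometer -/

/-- Matrix coefficients `x ↦ L (ρ x⁻¹ v)` embed an irreducible representation of `G / Γ_n` into
`L²` of the inverse limit. -/
theorem exists_injective_intertwiningMap {F : Type*} [AddCommGroup F] [Module ℂ F]
    {ρ : Representation ℂ G F} (hρ : ρ.IsIrreducible) {n : ℕ} (hn : ∀ g ∈ Γ.sub n, ρ g = 1) :
    ∃ T : ρ.IntertwiningMap Γ.koopman, Function.Injective T := by
  have := hρ.nontrivial
  obtain ⟨v, hv⟩ := exists_ne (0 : F)
  obtain ⟨L, hL⟩ : ∃ L : Module.Dual ℂ F, L v ≠ 0 := by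
    by_contra! h
    exact hv ((Module.forall_dual_apply_eq_zero_iff ℂ v).mp h)
  let ρ' : G ⧸ Γ.sub n →* (F →ₗ[ℂ] F) := QuotientGroup.lift (Γ.sub n) ρ hn
  let T : ρ.IntertwiningMap Γ.koopman :=
    LinearMap.intertwiningMap_of_isIntertwiningMap (ρ := ρ) (σ := Γ.koopman)
      (f := Γ.levelMap n ∘ₗ LinearMap.pi fun c => L ∘ₗ ρ' c⁻¹) (fun g w => by
        rw [LinearMap.comp_apply, LinearMap.comp_apply, koopman_levelMap]
        congr 1
        funext c
        have hg : ρ g = ρ' (g : G ⧸ Γ.sub n) := rfl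
        simp [hg, mul_inv_rev, map_mul])
  refine ⟨T, (Representation.IsIrreducible.injective_or_eq_zero T).resolve_right fun hT => hL ?_⟩
  have h0 : Γ.levelMap n (fun c => L (ρ' c⁻¹ v)) = 0 := by
    have : T v = 0 := by rw [hT]; rfl
    exact this
  have h1 : L (ρ' (1 : G ⧸ Γ.sub n)⁻¹ v) = 0 := Γ.eq_zero_of_levelMap_eq_zero h0 1
  simpa using h1

/-- An irreducible finite dimensional representation occurs in the odometer if and only if it
factors through one of the finite quotients `G / Γ_n`. -/
theorem occursIn_koopman_iff {F : Type*} [AddCommGroup F] [Module ℂ F] [FiniteDimensional ℂ F]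
    {ρ : Representation ℂ G F} (hρ : ρ.IsIrreducible) :
    OccursIn ρ Γ.koopman ↔ ∃ n, ∀ g ∈ Γ.sub n, ρ g = 1 := by
  constructor
  · rintro ⟨S, hS, V, hV, ⟨e⟩⟩
    obtain ⟨n, hn⟩ := Representation.exists_forall_apply_eq_self Γ.inner_koopman Γ.level
      Γ.eq_zero_of_forall_inner_level V (hS.irreducible V hV)
    refine ⟨n, fun g hg => LinearMap.ext fun v => e.toLinearEquiv.injective ?_⟩
    have h := hn g (fun y hy => Γ.koopman_apply_of_mem (inv_mem hg) hy) _ (e v).2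
    have h' : e (ρ g v) = V.toRepresentation g (e v) := e.toIntertwiningMap.isIntertwining _ _ g v
    exact h'.trans (Subtype.ext h)
  · rintro ⟨n, hn⟩
    obtain ⟨T, hT⟩ := Γ.exists_injective_intertwiningMap hρ hn
    have e := T.equivRange hT
    have : FiniteDimensional ℂ T.range.toSubmodule := e.toLinearEquiv.finiteDimensional
    obtain ⟨S, hS, hTS⟩ := Representation.exists_isSpectralDecomposition_mem Γ.inner_koopman
      Γ.level Γ.finiteDimensional_level Γ.eq_zero_of_forall_inner_level T.range this
      (hρ.of_equiv e)
    exact ⟨S, hS, T.range, hTS, ⟨e⟩⟩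

end OdometerSeq

/-! ### The representations of the Heisenberg group -/

namespace Heisenberg

theorem phase_ne_zero (p : ℕ) (α ξ : ℝ) (l : ℤ) (g : Heisenberg) (j : ℕ) :
    phase p α ξ l g j ≠ 0 := Complex.exp_ne_zero _

theorem phase_eq_one_iff (p : ℕ) (α ξ : ℝ) (l : ℤ) (g : Heisenberg) (j : ℕ) :
    phase p α ξ l g j = 1 ↔ ∃ k : ℤ, (g.y : ℝ) * ξ + ((g.z + j * g.y : ℤ) : ℝ) * ((l : ℝ) / p)
      + (⌊((g.x + j : ℤ) : ℝ) / (p : ℝ)⌋ : ℝ) * α = k := by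
  unfold phase
  rw [Complex.exp_eq_one_iff]
  refine exists_congr fun k => ?_
  rw [mul_comm (k : ℂ), mul_right_inj' Complex.two_pi_I_ne_zero]
  exact_mod_cast Iff.rfl

theorem irrep_apply (p : ℕ) [NeZero p] (α ξ : ℝ) (l : ℤ) (g : Heisenberg)
    (v : EuclideanSpace ℂ (ZMod p)) (j : ZMod p) :
    irrep p α ξ l g v j = phase p α ξ l g j.val * v (j + (g.x : ZMod p)) := rfl

/-- The diagonal entries of `(0, k, 0)`: the second factor is `1` for `j < p`. -/
theorem phase_y (p : ℕ) (α ξ : ℝ) (l : ℤ) (k j : ℕ) :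
    phase p α ξ l ⟨0, k, 0⟩ j
      = Complex.exp (2 * Real.pi * Complex.I * ((ξ + j * (l / p) : ℝ) : ℂ)) ^ k
        * Complex.exp (2 * Real.pi * Complex.I * ((⌊(j : ℝ) / p⌋ * α : ℝ) : ℂ)) := by
  unfold phase
  rw [← Complex.exp_nat_mul, ← Complex.exp_add]
  congr 1
  push_cast
  simp only [zero_add]
  ring

/-- The eigenvalues of `(0, 1, 0)` are distinct, so that a nonzero invariant subspace contains a
coordinate vector, hence all of them, since `(1, 0, 0)` permutes the coordinates cyclically. -/
theorem irrep_isIrreducible {p : ℕ} [NeZero p] (α ξ : ℝ) {l : ℤ} (hlp : IsCoprime l (p : ℤ)) :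
    (irrep p α ξ l).IsIrreducible := by
  have hp0 : (p : ℂ) ≠ 0 := by exact_mod_cast NeZero.ne p
  refine .of_forall_eq_top fun K v hv hv0 => ?_
  obtain ⟨j₀, hj₀⟩ : ∃ j, v j ≠ 0 := by
    by_contra! h
    exact hv0 (by ext j; simpa using h j)
  have hmem : EuclideanSpace.single j₀ (1 : ℂ) ∈ K.toSubmodule := by
    let D : ℂ := Complex.exp (2 * Real.pi * Complex.I * ((⌊(j₀.val : ℝ) / p⌋ * α : ℝ) : ℂ))
    let E : ℕ → ℂ := fun j => Complex.exp (2 * Real.pi * Complex.I * ((ξ + j * (l / p) : ℝ) : ℂ))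
    -- averaging `(0, k, 0)` against the inverse of its eigenvalue at `j₀` leaves only the
    -- coordinate `j₀`: the other coordinates are multiplied by sums over nontrivial `p`-th roots of unity
    let u := ∑ k ∈ Finset.range p, (E j₀.val)⁻¹ ^ k • irrep p α ξ l ⟨0, k, 0⟩ v
    have hu : u ∈ K.toSubmodule := Submodule.sum_mem _ fun k _ =>
      K.toSubmodule.smul_mem _ (K.apply_mem_toSubmodule _ hv)
    have huj : ∀ j, u j = (∑ k ∈ Finset.range p, (E j.val / E j₀.val) ^ k)
        * (Complex.exp (2 * Real.pi * Complex.I * ((⌊(j.val : ℝ) / p⌋ * α : ℝ) : ℂ)) * v j) := by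
      intro j
      rw [Finset.sum_mul, WithLp.ofLp_sum, Finset.sum_apply]
      refine Finset.sum_congr rfl fun k _ => ?_
      rw [PiLp.smul_apply, irrep_apply, phase_y, smul_eq_mul, div_pow, inv_pow]
      simp only [E, Int.cast_zero, add_zero]
      ring
    have hsum : ∀ j, j ≠ j₀ → ∑ k ∈ Finset.range p, (E j.val / E j₀.val) ^ k = 0 := by
      intro j hj
      have hE : E j.val / E j₀.val
          = Complex.exp (2 * Real.pi * Complex.I * ((j.val - j₀.val) * l / p)) := by
        simp only [E]
        rw [← Complex.exp_sub]
        congr 1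
        push_cast
        ring
      have h1 : E j.val / E j₀.val ≠ 1 := by
        rw [hE, Ne, Complex.exp_eq_one_iff]
        rintro ⟨n, hn⟩
        rw [mul_comm (n : ℂ), mul_right_inj' Complex.two_pi_I_ne_zero, div_eq_iff hp0] at hn
        have hn' : ((j.val : ℤ) - j₀.val) * l = n * p := by exact_mod_cast hn
        have hdvd : (p : ℤ) ∣ (j.val : ℤ) - j₀.val :=
          hlp.symm.dvd_of_dvd_mul_right ⟨n, by rw [hn', mul_comm]⟩
        rw [← ZMod.intCast_zmod_eq_zero_iff_dvd] at hdvd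
        apply hj
        simpa [sub_eq_zero] using hdvd
      have h2 : (E j.val / E j₀.val) ^ p = 1 := by
        rw [hE, ← Complex.exp_nat_mul, Complex.exp_eq_one_iff]
        refine ⟨((j.val : ℤ) - j₀.val) * l, ?_⟩
        push_cast
        field_simp
      rw [geom_sum_eq h1, h2, sub_self, zero_div]
    have huv : u = (p * (D * v j₀)) • EuclideanSpace.single j₀ (1 : ℂ) := by
      ext j
      rw [huj]
      by_cases hj : j = j₀
      · subst hj
        simp [E, D]
      · rw [hsum j hj]
        simp [hj]
    exact (K.toSubmodule.smul_mem_iff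
      (mul_ne_zero hp0 (mul_ne_zero (Complex.exp_ne_zero _) hj₀))).mp (huv ▸ hu)
  have hall : ∀ j, EuclideanSpace.single j (1 : ℂ) ∈ K.toSubmodule := by
    intro j
    let g : Heisenberg := ⟨((j₀ - j).val : ℕ), 0, 0⟩
    have hg : (g.x : ZMod p) = j₀ - j := by simp [g]
    have h : irrep p α ξ l g (EuclideanSpace.single j₀ (1 : ℂ))
        = phase p α ξ l g j.val • EuclideanSpace.single j (1 : ℂ) := by
      ext i
      rw [irrep_apply, hg]
      by_cases hi : i = j
      · subst hi; simp
      · have : i + (j₀ - j) ≠ j₀ := fun e => hi (by linear_combination e)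
        simp [hi, this]
    exact (K.toSubmodule.smul_mem_iff (phase_ne_zero p α ξ l g j.val)).mp
      (h ▸ K.apply_mem_toSubmodule g hmem)
  rw [eq_top_iff, ← (EuclideanSpace.basisFun (ZMod p) ℂ).toBasis.span_eq, Submodule.span_le]
  rintro _ ⟨j, rfl⟩
  simpa using hall j

end Heisenberg

namespace Heisenberg.IsDefinedBy

variable {Γ : Subgroup Heisenberg} {A : Matrix (Fin 2) (Fin 2) ℤ} {m : ℕ} {i : lattice A → ℤ}

theorem mem_iff (h : IsDefinedBy Γ A m i) (g : Heisenberg) :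
    g ∈ Γ ↔ ∃ (v : lattice A) (k : ℤ), g = ⟨v.1 0, v.1 1, i v + k * m⟩ := by
  rw [← SetLike.mem_coe, h.coe_eq]; rfl

theorem center_mem_iff (h : IsDefinedBy Γ A m i) (c : ℤ) :
    (⟨0, 0, c⟩ : Heisenberg) ∈ Γ ↔ (m : ℤ) ∣ c := by
  obtain ⟨v, k, hv⟩ := (h.mem_iff 1).mp Γ.one_mem
  have hv0 : v.1 0 = 0 := (congrArg Heisenberg.x hv).symm
  have hv1 : v.1 1 = 0 := (congrArg Heisenberg.y hv).symm
  have hv2 : 0 = i v + k * m := congrArg Heisenberg.z hv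
  rw [h.mem_iff]
  constructor
  · rintro ⟨w, k', hw⟩
    have hw0 : 0 = w.1 0 := congrArg Heisenberg.x hw
    have hw1 : 0 = w.1 1 := congrArg Heisenberg.y hw
    have hw2 : c = i w + k' * m := congrArg Heisenberg.z hw
    have : w = v := by
      apply Subtype.ext
      funext a
      fin_cases a
      · exact hw0.symm.trans hv0.symm
      · exact hw1.symm.trans hv1.symm
    subst this
    exact ⟨k' - k, by linear_combination hw2 - hv2⟩
  · rintro ⟨d, rfl⟩
    refine ⟨v, k + d, ?_⟩
    ext
    · exact hv0.symm
    · exact hv1.symm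
    · change (m : ℤ) * d = i v + (k + d) * m
      linear_combination hv2

/-- The commutator of `(a, b, 0)` and `(x, y, z)` is `(0, 0, a y - b x)`. -/
theorem dvd_of_mem (h : IsDefinedBy Γ A m i) [Γ.Normal] {g : Heisenberg} (hg : g ∈ Γ) :
    (m : ℤ) ∣ g.x ∧ (m : ℤ) ∣ g.y := by
  have key : ∀ a b : ℤ, (m : ℤ) ∣ a * g.y - b * g.x := by
    intro a b
    rw [← h.center_mem_iff]
    have := Γ.mul_mem (Subgroup.Normal.conj_mem ‹_› g hg ⟨a, b, 0⟩) (Γ.inv_mem hg)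
    convert this using 1
    ext <;> simp
    ring
  exact ⟨by simpa using key 0 1, by simpa using key 1 0⟩

/-- Triviality on the central element `(0, 0, m)` means `p ∣ m`. Then `p` also divides `x` and `y`
for every `(x, y, z) ∈ Γ`, so that such an element acts as multiplication by the scalar
`exp (2πi (y ξ + z ℓ/p + (x/p) α))`. -/
theorem forall_irrep_eq_one_iff (h : IsDefinedBy Γ A m i) [Γ.Normal] (α ξ : ℝ) (p : ℕ) [NeZero p]
    (l : ℤ) (hlp : IsCoprime l (p : ℤ)) :
    (∀ g ∈ Γ, irrep p α ξ l g = 1) ↔ p ∣ m ∧ ∀ v : lattice A, ∃ k : ℤ,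
      (v.1 1 : ℝ) * ξ + (i v : ℝ) * (l : ℝ) / (p : ℝ) + (v.1 0 : ℝ) / (p : ℝ) * α = (k : ℝ) := by
  have hp : (p : ℝ) ≠ 0 := by exact_mod_cast NeZero.ne p
  constructor
  · intro hΓ
    have hphase : ∀ g ∈ Γ, phase p α ξ l g 0 = 1 := by
      intro g hg
      have h1 := congrArg (fun w : EuclideanSpace ℂ (ZMod p) => w 0)
        (LinearMap.congr_fun (hΓ g hg) (WithLp.toLp 2 fun _ => (1 : ℂ)))
      simpa [irrep_apply] using h1
    have hpm : (p : ℤ) ∣ m := by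
      obtain ⟨k, hk⟩ := (phase_eq_one_iff ..).mp (hphase _ ((h.center_mem_iff m).mpr dvd_rfl))
      refine hlp.symm.dvd_of_dvd_mul_right ⟨k, ?_⟩
      simp at hk
      field_simp at hk
      exact_mod_cast hk
    refine ⟨Int.natCast_dvd_natCast.mp hpm, fun v => ?_⟩
    have hg : (⟨v.1 0, v.1 1, i v⟩ : Heisenberg) ∈ Γ := (h.mem_iff _).mpr ⟨v, 0, by simp⟩
    obtain ⟨q, hq⟩ := hpm.trans (h.dvd_of_mem hg).1
    obtain ⟨k, hk⟩ := (phase_eq_one_iff ..).mp (hphase _ hg)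
    refine ⟨k, ?_⟩
    change v.1 0 = p * q at hq
    rw [← hk]
    simp only [hq]
    push_cast
    rw [add_zero, mul_div_cancel_left₀ _ hp, Int.floor_intCast]
    ring
  · rintro ⟨hpm, hv⟩ g hg
    have hpm' : (p : ℤ) ∣ m := Int.natCast_dvd_natCast.mpr hpm
    obtain ⟨q, hq⟩ := hpm'.trans (h.dvd_of_mem hg).1
    obtain ⟨r, hr⟩ := hpm'.trans (h.dvd_of_mem hg).2
    obtain ⟨d, hd⟩ := hpm
    obtain ⟨v, k, rfl⟩ := (h.mem_iff g).mp hg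
    obtain ⟨c, hc⟩ := hv v
    change v.1 0 = p * q at hq
    change v.1 1 = p * r at hr
    ext w j
    have hx : ((v.1 0 : ℤ) : ZMod p) = 0 := by rw [hq]; simp
    rw [irrep_apply]
    simp only [hx, add_zero]
    suffices hph : phase p α ξ l ⟨v.1 0, v.1 1, i v + k * m⟩ j.val = 1 by rw [hph, one_mul]; rfl
    rw [phase_eq_one_iff]
    have hfl : ⌊((v.1 0 + (j.val : ℕ) : ℤ) : ℝ) / (p : ℝ)⌋ = q := by
      have hj : (j.val : ℝ) < p := by exact_mod_cast ZMod.val_lt j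
      have hp' : (0 : ℝ) < p := by positivity
      rw [hq]
      push_cast
      rw [add_div, mul_div_cancel_left₀ _ hp, Int.floor_intCast_add,
        Int.floor_eq_zero_iff.mpr, add_zero]
      exact ⟨by positivity, (div_lt_one hp').mpr hj⟩
    refine ⟨c + k * d * l + j.val * r * l, ?_⟩
    simp only [hfl]
    push_cast
    rw [← hc, hd, hq, hr]
    push_cast
    field_simp
    ring

end Heisenberg.IsDefinedBy

theorem mainTheorem4 (Γ : OdometerSeq Heisenberg)
    (A : ℕ → Matrix (Fin 2) (Fin 2) ℤ) (m : ℕ → ℕ) (i : ∀ n, Heisenberg.lattice (A n) → ℤ)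
    (hΓ : ∀ n, Heisenberg.IsDefinedBy (Γ.sub n) (A n) (m n) (i n))
    (α ξ : ℝ) (p : ℕ) [NeZero p] (l : ℤ) (hlp : IsCoprime l (p : ℤ)) :
    OccursIn (Heisenberg.irrep p α ξ l) Γ.koopman ↔
      ∃ n, p ∣ m n ∧ ∀ v : Heisenberg.lattice (A n), ∃ k : ℤ,
        (v.1 1 : ℝ) * ξ + (i n v : ℝ) * (l : ℝ) / (p : ℝ) + (v.1 0 : ℝ) / (p : ℝ) * α
          = (k : ℝ) := by
  rw [Γ.occursIn_koopman_iff (Heisenberg.irrep_isIrreducible α ξ hlp)]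
  exact exists_congr fun n => (hΓ n).forall_irrep_eq_one_iff α ξ p l hlp
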